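/- Let $\Psi=\{f_i\}_{i\in M}$, $M=\{0,\dots,m-1\}$, be a system of contracting similitudes of $\mathbb{R}^n$ ($n\ge 1$) with ratios $r_i\in(0,1)$, and let $E$ be the self-similar set of $\Psi$, i.e. the unique non-empty compact set with $E=\bigcup_{i\in M} f_i(E)$. A non-empty open set $\mathcal{O}$ is *feasible* for $\Psi$ if $f_i(\mathcal{O})\subset\mathcal{O}$ for all $i$ and $f_i(\mathcal{O})\cap f_j(\mathcal{O})=\varnothing$ for $i\ne j$; assume that a feasible open set $\mathcal{O}$ is given. Let $\mathbf{p}=(p_i)_{i\in M}$ with $p_i>0$ and $\sum_i p_i=1$, and let $\mu_{\mathbf p}$ be the self-similar measure, i.e. the unique compactly supported Borel probability measure with $\mu_{\mathbf p}=\sum_i p_i\,(f_i)_\sharp\mu_{\mathbf p}$. For a finite word $w=w_1\cdots w_k\in M^*=\bigcup_{k\ge0}M^k$ put $f_w=f_{w_1}\circ\cdots\circ f_{w_k}$, $r_w=r_{w_1}\cdots r_{w_k}$, $p_w=p_{w_1}\cdots p_{w_k}$. $B(x,d)$, $d>0$, denotes a closed Euclidean ball, $\alpha\lfloor_A$ a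 restriction, $g_\sharp\alpha$ an image measure, and $\alpha_j\xrightarrow{st}\alpha$ means $\alpha_j(A)\to\alpha(A)$ for every Borel set $A$. Let $\pi:M^{\mathbb N}\to E$, $\{\pi(i)\}=\bigcap_{k} f_{i_1\cdots i_k}(E)$, let $\sigma$ be the shift on $M^{\mathbb N}$, let $\mathcal{T}=\pi\circ\sigma\circ\pi^{-1}$ be the (set-valued) geometric shift on $E$, and let $\widehat E$ be the set of $y\in E$ such that $\bigcup_{k\ge1}\mathcal{T}^k(y)$ is dense in $E$. For Radon measures on $\mathbb{R}^n$ write $\alpha\cong\beta$ if $\beta=\lambda\, g_\sharp\alpha$ for some isometry $g$ of $\mathbb{R}^n$ and some $\lambda>0$, and let $\widetilde\alpha$ be the class of $\alpha$. For $R>0$, a Radon measure $\nu$ and $x\in\operatorname{spt}\nu$, let $\widetilde{Tan}^{st}_R(\nu,x)$ be the set of classes $\widetilde\alpha$ of non-null Radon measures $\alpha$ for which there are $0<d\le R$, constants $c_k>0$ and similitudes $g_k$ of ratios $t_k\to\infty$ such that $$c_k\,\nu(B(x,d/t_k))^{-1}\,(g_k)_\sharp\bigl(\nu\lfloor_{B(x,d/t_k)}\bigr)\xrightarrow[k\to\infty]{st}\alpha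 .$$ ($\widetilde{Tan}^{st}=\widetilde{Tan}^{st}_1$ is the usual normalisation.) A ball $B(z,d)$ is *typical* if $z\in E$ and $B(z,d)$ is contained in some feasible open set. Then the following hold. (i) For every $\mu_{\mathbf p}$-measurable $B\subset\mathcal{O}$ and every $w\in M^*$, $\ \mu_{\mathbf p}\lfloor_{f_w(B)}=p_w\,(f_w)_\sharp(\mu_{\mathbf p}\lfloor_B)$. (ii) For every $\mu_{\mathbf p}$-measurable $B\subset\mathcal{O}$ and every $w\in M^*$, $\ \mu_{\mathbf p}\lfloor_{B}=p_w^{-1}\,(f_w^{-1})_\sharp(\mu_{\mathbf p}\lfloor_{f_w(B)})$. (iii) $\widehat E\subset E$ has full measure, $\mu_{\mathbf p}(\widehat E)=1$, and for every $x\in E$ and $d>0$ with $B(x,d)\subset\mathcal{O}$ and every $y\in\widehat E$ there are words $w_j\in M^*$ with $r_{w_j}\to0$ and $$p_{w_j}^{-1}\,(f_{w_j}^{-1})_\sharp\bigl(\mu_{\mathbf p}\lfloor_{B(y,d\,r_{w_j})}\bigr)\xrightarrow[j\to\infty]{st}\mu_{\mathbf p}\lfloor_{B(x,d)} .$$ (iv)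 For every $R>0$, every $x\in\widehat E$ and every typical ball $B$ of radius at most $R$, the class of $\mu_{\mathbf p}\lfloor_B$ belongs to $\widetilde{Tan}^{st}_R(\mu_{\mathbf p},x)$. In particular, if all typical balls have radius at most $1$, then $\{\widetilde{\mu_{\mathbf p}\lfloor_B}: B \text{ typical}\}\subset\widetilde{Tan}^{st}(\mu_{\mathbf p},x)$ for every $x\in\widehat E$. -/

import Mathlib

open MeasureTheory Metric Filter Topology
open scoped NNReal ENNReal

noncomputable section

/-- Euclidean space `ℝⁿ`. -/
abbrev Eucl (n : ℕ) : Type := EuclideanSpace ℝ (Fin n)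

/-! ### Words, self-similar sets, feasible open sets -/

/-- `f_w = f_{w₁} ∘ f_{w₂} ∘ ⋯ ∘ f_{w_k}` for a finite word `w` (the product is composition in the
group of similitudes; the empty word gives the identity). -/
def wordMap {n m : ℕ} (f : Fin m → Eucl n ≃ᵈ Eucl n) (w : List (Fin m)) : Eucl n ≃ᵈ Eucl n :=
  (w.map f).prod

/-- `a_w = a_{w₁} a_{w₂} ⋯ a_{w_k}`, used for probability weights and for contraction ratios. -/
def wordProd {m : ℕ} (a : Fin m → ℝ≥0) (w : List (Fin m)) : ℝ≥0 :=
  (w.map a).prod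

/-- The contraction ratio `r_w` of `f_w`. -/
def wordRatio {n m : ℕ} (f : Fin m → Eucl n ≃ᵈ Eucl n) (w : List (Fin m)) : ℝ≥0 :=
  wordProd (fun i => Dilation.ratio (f i)) w

/-- `E` is the self-similar set generated by `f`: the non-empty compact set `E = ⋃ᵢ fᵢ(E)`. -/
structure IsSelfSimilarSet {n m : ℕ} (f : Fin m → Eucl n ≃ᵈ Eucl n) (E : Set (Eucl n)) :
    Prop where
  nonempty : E.Nonempty
  isCompact : IsCompact E
  eq_iUnion : E = ⋃ i, f i '' E

/-- `O` is a feasible open set for `f`, that is, it witnesses the open set condition. -/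
structure IsFeasible {n m : ℕ} (f : Fin m → Eucl n ≃ᵈ Eucl n) (O : Set (Eucl n)) : Prop where
  isOpen : IsOpen O
  nonempty : O.Nonempty
  image_subset : ∀ i, f i '' O ⊆ O
  disjoint : ∀ i j, i ≠ j → Disjoint (f i '' O) (f j '' O)

/-- The closed ball `B(x, d)`, `d > 0`, is typical: it is centred in `E` and contained in some
feasible open set. -/
def IsTypicalBall {n m : ℕ} (f : Fin m → Eucl n ≃ᵈ Eucl n) (E : Set (Eucl n))
    (x : Eucl n) (d : ℝ) : Prop :=
  0 < d ∧ x ∈ E ∧ ∃ O, IsFeasible f O ∧ closedBall x d ⊆ O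

/-- `μ` is the self-similar measure of `f` with weights `p`: the compactly supported Borel
probability measure fixed by the Markov operator, `μ = ∑ᵢ pᵢ (fᵢ)_♯ μ`. -/
structure IsSelfSimilarMeasure {n m : ℕ} (f : Fin m → Eucl n ≃ᵈ Eucl n) (p : Fin m → ℝ≥0)
    (μ : Measure (Eucl n)) : Prop where
  isProbabilityMeasure : IsProbabilityMeasure μ
  compactSupport : ∃ K, IsCompact K ∧ μ Kᶜ = 0
  fixed : μ = ∑ i, p i • μ.map (f i)

/-! ### The geometric shift -/

/-- The set `⋂ₖ f_{i₁⋯i_k}(E) = {π(i)}`, where `π` is the geometric projection of the code space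
onto `E`. -/
def codePoint {n m : ℕ} (f : Fin m → Eucl n ≃ᵈ Eucl n) (E : Set (Eucl n)) (i : ℕ → Fin m) :
    Set (Eucl n) :=
  ⋂ k : ℕ, wordMap f ((List.range k).map i) '' E

/-- The geometric shift `T = π ∘ σ ∘ π⁻¹` (a correspondence), acting on sets. -/
def geomShift {n m : ℕ} (f : Fin m → Eucl n ≃ᵈ Eucl n) (E A : Set (Eucl n)) : Set (Eucl n) :=
  {z | ∃ i : ℕ → Fin m, (codePoint f E i ∩ A).Nonempty ∧ z ∈ codePoint f E (fun k => i (k + 1))}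

/-- `Ê`: the points of `E` whose orbit `⋃_{k ≥ 1} Tᵏ(y)` is dense in `E`. -/
def denseOrbitSet {n m : ℕ} (f : Fin m → Eucl n ≃ᵈ Eucl n) (E : Set (Eucl n)) :
    Set (Eucl n) :=
  {y | y ∈ E ∧ E ⊆ closure (⋃ k : ℕ, (geomShift f E)^[k + 1] {y})}

/-! ### Strong convergence and classes of measures -/

/-- Strong (setwise) convergence of measures. -/
def StrongTendsto {n : ℕ} (α : ℕ → Measure (Eucl n)) (β : Measure (Eucl n)) : Prop :=
  ∀ A, MeasurableSet A → Tendsto (fun j => α j A) atTop (𝓝 (β A))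

/-- Radon measures on `ℝⁿ` (on this space: locally finite Borel measures). -/
abbrev RadonMeasure (n : ℕ) : Type := {α : Measure (Eucl n) // IsLocallyFiniteMeasure α}

/-- `α ≅ β` when `β = c g_♯ α` for some isometry `g` of `ℝⁿ` and some `c > 0`. -/
def MeasEquiv {n : ℕ} (α β : RadonMeasure n) : Prop :=
  ∃ (g : Eucl n ≃ᵢ Eucl n) (c : ℝ≥0), 0 < c ∧ β.1 = c • α.1.map g

theorem measEquiv_equivalence (n : ℕ) : Equivalence (MeasEquiv (n := n)) where
  refl α := ⟨IsometryEquiv.refl _, 1, one_pos, by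
    rw [one_smul]; exact Measure.map_id.symm⟩
  symm := by
    rintro α β ⟨g, c, hc, h⟩
    refine ⟨g.symm, c⁻¹, inv_pos.2 hc, ?_⟩
    rw [h, Measure.map_smul, smul_smul, inv_mul_cancel₀ hc.ne', one_smul,
      Measure.map_map g.symm.continuous.measurable g.continuous.measurable, show (g.symm : Eucl n → Eucl n) ∘ g = id from
        funext fun x => g.symm_apply_apply x, Measure.map_id]
  trans := by
    rintro α β γ ⟨g, c, hc, h⟩ ⟨g', c', hc', h'⟩
    refine ⟨g.trans g', c' * c, mul_pos hc' hc, ?_⟩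
    rw [h', h, Measure.map_smul, smul_smul,
      Measure.map_map g'.continuous.measurable g.continuous.measurable]
    rfl

/-- The setoid of `≅` on Radon measures. -/
def measSetoid (n : ℕ) : Setoid (RadonMeasure n) := ⟨MeasEquiv, measEquiv_equivalence n⟩

/-- Classes of Radon measures up to isometries and positive multiples. -/
abbrev MeasClass (n : ℕ) : Type := Quotient (measSetoid n)

/-- The class of a Radon measure. -/
def RadonMeasure.toClass {n : ℕ} (α : RadonMeasure n) : MeasClass n := Quotient.mk (measSetoid n) α

/-- The normalised zooming of `ν` at `x` by a similitude `g` of ratio `t`: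
`ν(B(x, d/t))⁻¹ g_♯(ν⌊B(x, d/t))`. -/
def zoom {n : ℕ} (ν : Measure (Eucl n)) (x : Eucl n) (d : ℝ) (g : Eucl n ≃ᵈ Eucl n) :
    Measure (Eucl n) :=
  (ν (closedBall x (d / Dilation.ratio g)))⁻¹ •
    (ν.restrict (closedBall x (d / Dilation.ratio g))).map g

/-- Strong tangent measure classes of `ν` at `x ∈ spt ν` with zooming windows of radius `d ≤ R`:
classes of the non-null Radon measures that are strong limits of `c_k • zoom ν x d g_k`, with
`c_k > 0`, similitudes `g_k` whose ratios tend to `∞`, and a fixed `0 < d ≤ R`. The customary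
normalisation is `R = 1`. -/
def strongTangentClasses {n : ℕ} (R : ℝ) (ν : Measure (Eucl n)) (x : Eucl n) :
    Set (MeasClass n) :=
  {C | x ∈ ν.support ∧ ∃ α : RadonMeasure n, α.toClass = C ∧ α.1 ≠ 0 ∧
    ∃ d : ℝ, 0 < d ∧ d ≤ R ∧ ∃ (c : ℕ → ℝ≥0) (g : ℕ → Eucl n ≃ᵈ Eucl n),
      (∀ k, 0 < c k) ∧ Tendsto (fun k => Dilation.ratio (g k)) atTop atTop ∧
      StrongTendsto (fun k => c k • zoom ν x d (g k)) α.1}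

/-- Classes of the typical spherical measures `μ⌊B`, `B` a typical ball of radius at most `R`. -/
def typicalClasses {n m : ℕ} (R : ℝ) (f : Fin m → Eucl n ≃ᵈ Eucl n) (E : Set (Eucl n))
    (μ : Measure (Eucl n)) : Set (MeasClass n) :=
  {C | ∃ α : RadonMeasure n, α.toClass = C ∧
    ∃ (z : Eucl n) (d : ℝ), IsTypicalBall f E z d ∧ d ≤ R ∧ α.1 = μ.restrict (closedBall z d)}

end

/-! The scaling identities come from the open set condition. `E` lies in the closure of `O`, while
for `j ≠ i` the open set `f_j⁻¹(f_i(O))` is disjoint from `O`, hence from `E`. So for `S ⊆ O` only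
the `i`-th term of the invariance equation charges `f_i(S)`, and `μ(f_i(S)) = p_i μ(S)`
(`measure_image_of_subset`).

The geometric shift acts by inverse branches, so `y ∈ Ê` means that the points `z ∈ E` with `f_w(z)
= y` for some nonempty `w` are dense in `E`. Almost every `y` has this property: each cylinder word
reappears after a nonempty prefix in some code of `y`, because the exceptional set `N` satisfies
`f_i⁻¹(N) ⊆ N` and stationarity turns these inclusions into equalities modulo null sets
(`measure_compl_denseOrbitSet`).

Given `y ∈ Ê`, choose longer and longer words with `f_{w_j}(z_j) = y` and `z_j → x`. Scaling turns
the zoomed measures into exactly `μ⌊B(z_j, d)`. These converge setwise to `μ⌊B(x, d)` as soon as the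
sphere of radius `d` about `x` is null.

Null spheres rest on a maximum principle (`measure_zeroSet_eq_zero`). The span of constants and
squared distances is finite-dimensional and preserved by composition with each `f_i`, so some
nonzero `q` in it has a zero set of largest measure. If that measure were positive, stationarity
would pass it to every `q ∘ f_w`; then `q` would vanish somewhere in each cylinder, hence on a dense
set, hence identically. -/

/-- If a convex combination with positive weights of numbers `a j ≤ M` equals `M`, then every
`a j` equals `M`. -/
theorem ENNReal.eq_of_sum_mul_eq {ι : Type*} [Fintype ι] {p : ι → ℝ≥0} (hp : ∀ i, 0 < p i)
    (hsum : ∑ i, p i = 1) {a : ι → ℝ≥0∞} {M : ℝ≥0∞} (hM : M ≠ ∞) (ha : ∀ i, a i ≤ M)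
    (h : ∑ i, (p i : ℝ≥0∞) * a i = M) (i : ι) : a i = M := by
  classical
  by_contra hne
  have hlt : (p i : ℝ≥0∞) * a i < p i * M :=
    (ENNReal.mul_lt_mul_iff_right (by simpa using (hp i).ne') ENNReal.coe_ne_top).2
      (lt_of_le_of_ne (ha i) hne)
  have hle : ∑ j ∈ Finset.univ.erase i, (p j : ℝ≥0∞) * a j ≤
      ∑ j ∈ Finset.univ.erase i, (p j : ℝ≥0∞) * M :=
    Finset.sum_le_sum fun j _ => mul_le_mul_right (ha j) _
  have hfin : ∑ j ∈ Finset.univ.erase i, (p j : ℝ≥0∞) * a j ≠ ∞ :=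
    ENNReal.sum_ne_top.2 fun j _ => ENNReal.mul_ne_top ENNReal.coe_ne_top
      (ne_top_of_le_ne_top hM (ha j))
  have key := ENNReal.add_lt_add_of_lt_of_le hfin hlt hle
  rw [Finset.add_sum_erase _ (fun j => (p j : ℝ≥0∞) * a j) (Finset.mem_univ i),
    Finset.add_sum_erase _ (fun j => (p j : ℝ≥0∞) * M) (Finset.mem_univ i), h, ← Finset.sum_mul,
    ← ENNReal.ofNNReal_finsetSum, hsum, ENNReal.coe_one, one_mul] at key
  exact key.false

/-! ### Zero sets in finite-dimensional invariant function spaces -/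

/-- The composition `φ_{w₁} ∘ ⋯ ∘ φ_{w_k}` of continuous self-maps along a finite word. -/
def contWordMap {X ι : Type*} [TopologicalSpace X] (φ : ι → C(X, X)) (w : List ι) : C(X, X) :=
  w.foldr (fun i g => (φ i).comp g) (ContinuousMap.id X)

section ZeroSets

variable {X : Type*} [TopologicalSpace X] [CompactSpace X] [MeasurableSpace X] [BorelSpace X]

/-- The sets `{|q| ≤ 1/(k+1)}` decrease to the zero set of `q`, and they contain the zeros of every
`g` uniformly within `1/(k+1)` of `q`. -/
theorem upperSemicontinuous_measure_zeroSet (ν : Measure X) [IsFiniteMeasure ν] :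
    UpperSemicontinuous fun q : C(X, ℝ) => ν {x | q x = 0} := by
  intro q c hc
  have hlim : Tendsto (fun k : ℕ => ν {x | |q x| ≤ 1 / ((k : ℝ) + 1)}) atTop
      (𝓝 (ν (⋂ k : ℕ, {x | |q x| ≤ 1 / ((k : ℝ) + 1)}))) := by
    refine tendsto_measure_iInter_atTop (fun k => ?_) ?_ ⟨0, measure_ne_top _ _⟩
    · exact (isClosed_le (by fun_prop) continuous_const).measurableSet.nullMeasurableSet
    · intro j k hjk x hx
      exact le_trans (Set.mem_ofPred_eq ▸ hx)  (Nat.one_div_le_one_div hjk)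
  have hset : (⋂ k : ℕ, {x | |q x| ≤ 1 / ((k : ℝ) + 1)}) = {x | q x = 0} := by
    ext x
    simp only [Set.mem_iInter, Set.mem_ofPred_eq]
    constructor
    · intro h
      exact abs_nonpos_iff.1 (ge_of_tendsto' tendsto_one_div_add_atTop_nhds_zero_nat h)
    · intro h k
      rw [h, abs_zero]
      positivity
  rw [hset] at hlim
  obtain ⟨k, hk⟩ := (hlim.eventually_lt_const hc).exists
  filter_upwards [Metric.ball_mem_nhds q (Nat.one_div_pos_of_nat (α := ℝ) (n := k))] with g hg
  refine (measure_mono fun x (hx : g x = 0) => ?_).trans_lt hk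
  have h := (ContinuousMap.dist_apply_le_dist (f := g) (g := q) x).trans (mem_ball.1 hg).le
  rwa [hx, Real.dist_eq, zero_sub, abs_neg] at h

/-- Scaling does not change zero sets, so it suffices to maximise over the unit sphere of `Q`, which
is compact in finite dimension. -/
theorem exists_max_measure_zeroSet (ν : Measure X) [IsFiniteMeasure ν]
    (Q : Submodule ℝ C(X, ℝ)) [FiniteDimensional ℝ Q] (hQ : Q ≠ ⊥) :
    ∃ q ∈ Q, q ≠ 0 ∧ ∀ g ∈ Q, g ≠ 0 → ν {x | g x = 0} ≤ ν {x | q x = 0} := by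
  obtain ⟨g₀, hg₀, hne⟩ := Q.exists_mem_ne_zero_of_ne_bot hQ
  have : Nontrivial Q := ⟨⟨⟨g₀, hg₀⟩, 0, fun h => hne (congrArg Subtype.val h)⟩⟩
  have : ProperSpace Q := FiniteDimensional.proper_real Q
  have husc : UpperSemicontinuousOn (fun q : Q => ν {x | q.1 x = 0}) (sphere 0 1) :=
    fun q _ => ((upperSemicontinuous_measure_zeroSet ν).comp continuous_subtype_val
      |>.upperSemicontinuousAt q).upperSemicontinuousWithinAt _
  obtain ⟨q, hq, hmax⟩ := husc.exists_isMaxOn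
    (NormedSpace.sphere_nonempty.2 zero_le_one) (isCompact_sphere (0 : Q) 1)
  refine ⟨q.1, q.2, fun h => ?_, fun g hg hg0 => ?_⟩
  · have : q = 0 := Subtype.ext h
    simp [this] at hq
  · have hn : ‖g‖ ≠ 0 := norm_ne_zero_iff.2 hg0
    have h := hmax (a := ⟨‖g‖⁻¹ • g, Q.smul_mem _ hg⟩) (by
      rw [mem_sphere_zero_iff_norm]
      change ‖‖g‖⁻¹ • g‖ = 1
      rw [norm_smul, norm_inv, norm_norm, inv_mul_cancel₀ hn])
    refine (measure_mono fun x hx => ?_).trans h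
    have hx' : g x = 0 := hx
    simp [hx']

/-- Let `ν` be stationary for a weighted system `φ` whose cylinders are arbitrarily small, and let
`Q` be a finite-dimensional space of continuous functions on which every `φ i` acts surjectively
by composition. Then the zero set of a nonzero element of `Q` is `ν`-null. -/
theorem measure_zeroSet_eq_zero {ι : Type*} [Fintype ι] (ν : Measure X) [IsFiniteMeasure ν]
    (φ : ι → C(X, X)) (p : ι → ℝ≥0) (hp : ∀ i, 0 < p i) (hsum : ∑ i, p i = 1)
    (hν : ∀ A, IsClosed A → ν A = ∑ i, (p i : ℝ≥0∞) * ν (φ i ⁻¹' A))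
    (hsmall : ∀ U : Set X, IsOpen U → U.Nonempty → ∃ w : List ι, ∀ x, contWordMap φ w x ∈ U)
    (Q : Submodule ℝ C(X, ℝ)) [FiniteDimensional ℝ Q]
    (hQ : ∀ i, ∀ q ∈ Q, q.comp (φ i) ∈ Q)
    (hQ' : ∀ i, ∀ q ∈ Q, ∃ q' ∈ Q, q'.comp (φ i) = q)
    {q : C(X, ℝ)} (hq : q ∈ Q) (hq0 : q ≠ 0) : ν {x | q x = 0} = 0 := by
  obtain ⟨q₀, hq₀, hne, hmax⟩ := exists_max_measure_zeroSet ν Q (Q.ne_bot_iff.2 ⟨q, hq, hq0⟩)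
  by_contra hpos
  set M := ν {x | q₀ x = 0} with hM
  have hM0 : M ≠ 0 := fun h => hpos (le_zero_iff.1 (h ▸ hmax q hq hq0))
  -- A surjective endomorphism of a finite-dimensional space is injective.
  have hinj : ∀ i, ∀ g ∈ Q, g ≠ 0 → g.comp (φ i) ≠ 0 := by
    intro i g hg hg0 h
    let T : Q →ₗ[ℝ] Q :=
      { toFun := fun g => ⟨g.1.comp (φ i), hQ i _ g.2⟩
        map_add' := fun _ _ => rfl
        map_smul' := fun _ _ => rfl }
    have hs : Function.Surjective T := fun g => by
      obtain ⟨g', hg', h⟩ := hQ' i g.1 g.2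
      exact ⟨⟨g', hg'⟩, Subtype.ext h⟩
    have h1 : T ⟨g, hg⟩ = T 0 := by rw [map_zero]; exact Subtype.ext h
    exact hg0 (congrArg Subtype.val (LinearMap.injective_iff_surjective.2 hs h1))
  -- Stationarity writes `M` as a weighted mean of the measures of the zero sets of the `g ∘ φ_j`,
  -- each at most `M` by maximality.
  have hstep : ∀ i, ∀ g ∈ Q, g ≠ 0 → ν {x | g x = 0} = M → ν {x | g.comp (φ i) x = 0} = M := by
    intro i g hg hg0 hgM
    have hle : ∀ j, ν {x | g.comp (φ j) x = 0} ≤ M :=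
      fun j => hmax _ (hQ j g hg) (hinj j g hg hg0)
    have h := hν {x | g x = 0} (isClosed_eq g.continuous continuous_const)
    exact ENNReal.eq_of_sum_mul_eq hp hsum (measure_ne_top _ _) hle (h.symm.trans hgM) i
  have hword : ∀ w : List ι, ∀ g ∈ Q, g ≠ 0 → ν {x | g x = 0} = M →
      ∃ x, g (contWordMap φ w x) = 0 := by
    intro w
    induction w with
    | nil =>
      intro g _ _ hgM
      obtain ⟨x, hx⟩ := nonempty_of_measure_ne_zero (hgM.symm ▸ hM0)
      exact ⟨x, hx⟩
    | cons i w ih =>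
      intro g hg hg0 hgM
      exact ih (g.comp (φ i)) (hQ i g hg) (hinj i g hg hg0) (hstep i g hg hg0 hgM)
  refine hne (ContinuousMap.ext fun x => ?_)
  by_contra hx
  obtain ⟨w, hw⟩ := hsmall {x | q₀ x ≠ 0} (isOpen_ne_fun q₀.continuous continuous_const) ⟨x, hx⟩
  obtain ⟨y, hy⟩ := hword w q₀ hq₀ hne rfl
  exact hw y hy

end ZeroSets

/-! ### Words -/

section Words

variable {n m : ℕ} (f : Fin m → Eucl n ≃ᵈ Eucl n)

@[simp]
theorem wordMap_nil_apply (x : Eucl n) : wordMap f [] x = x := rfl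

theorem wordMap_cons_apply (i : Fin m) (w : List (Fin m)) (x : Eucl n) :
    wordMap f (i :: w) x = f i (wordMap f w x) := by
  simp [wordMap]

theorem wordMap_append_apply (v w : List (Fin m)) (x : Eucl n) :
    wordMap f (v ++ w) x = wordMap f v (wordMap f w x) := by
  simp [wordMap]

theorem wordProd_cons (a : Fin m → ℝ≥0) (i : Fin m) (w : List (Fin m)) :
    wordProd a (i :: w) = a i * wordProd a w := by
  simp [wordProd]

theorem wordProd_pos {a : Fin m → ℝ≥0} (ha : ∀ i, 0 < a i) (w : List (Fin m)) :
    0 < wordProd a w := by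
  induction w with
  | nil => simp [wordProd]
  | cons i w ih => rw [wordProd_cons]; exact mul_pos (ha i) ih

theorem wordRatio_eq_ratio (w : List (Fin m)) :
    wordRatio f w = Dilation.ratio (wordMap f w) := by
  have h := (DilationEquiv.ratioHom (X := Eucl n)).map_list_prod (w.map f)
  rw [List.map_map] at h
  exact h.symm

theorem wordRatio_pos (w : List (Fin m)) : 0 < wordRatio f w := by
  rw [wordRatio_eq_ratio]
  exact Dilation.ratio_pos _

theorem wordRatio_le_pow {r : ℝ≥0} (hr : ∀ i, Dilation.ratio (f i) ≤ r) (w : List (Fin m)) :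
    wordRatio f w ≤ r ^ w.length := by
  induction w with
  | nil => simp [wordRatio, wordProd]
  | cons i w ih =>
    rw [wordRatio, wordProd_cons, List.length_cons, pow_succ']
    exact mul_le_mul' (hr i) ih

theorem exists_ratio_le (hf : ∀ i, Dilation.ratio (f i) < 1) :
    ∃ r : ℝ≥0, r < 1 ∧ ∀ i, Dilation.ratio (f i) ≤ r :=
  ⟨Finset.univ.sup fun i => Dilation.ratio (f i),
    (Finset.sup_lt_iff (by simp)).2 fun i _ => hf i,
    fun i => Finset.le_sup (f := fun i => Dilation.ratio (f i)) (Finset.mem_univ i)⟩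

theorem tendsto_wordRatio_of_length (hf : ∀ i, Dilation.ratio (f i) < 1)
    {w : ℕ → List (Fin m)} (hw : ∀ j, j ≤ (w j).length) :
    Tendsto (fun j => wordRatio f (w j)) atTop (𝓝 0) := by
  obtain ⟨r, hr1, hr⟩ := exists_ratio_le f hf
  refine tendsto_of_tendsto_of_tendsto_of_le_of_le tendsto_const_nhds
    (tendsto_pow_atTop_nhds_zero_of_lt_one zero_le hr1) (fun _ => zero_le)
    fun j => (wordRatio_le_pow f hr (w j)).trans (pow_le_pow_of_le_one zero_le hr1.le (hw j))

theorem Dilation.preimage_closedBall_apply (g : Eucl n ≃ᵈ Eucl n) (z : Eucl n) (d : ℝ) :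
    g ⁻¹' closedBall (g z) (d * Dilation.ratio g) = closedBall z d := by
  ext x
  rw [Set.mem_preimage, mem_closedBall, mem_closedBall, Dilation.dist_eq, mul_comm,
    mul_le_mul_iff_left₀ (by exact_mod_cast Dilation.ratio_pos g)]

theorem Dilation.infDist_apply_le (g : Eucl n ≃ᵈ Eucl n) {A : Set (Eucl n)} (hA : A.Nonempty)
    (hg : g '' A ⊆ A) (x : Eucl n) : infDist (g x) A ≤ Dilation.ratio g * infDist x A := by
  have hr : (0 : ℝ) < Dilation.ratio g := by exact_mod_cast Dilation.ratio_pos g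
  rw [← div_le_iff₀' hr]
  refine (le_infDist hA).2 fun y hy => ?_
  rw [div_le_iff₀' hr, ← Dilation.dist_eq]
  exact infDist_le_dist_of_mem (hg ⟨y, hy, rfl⟩)

end Words

/-! ### Self-similar sets -/

namespace IsSelfSimilarSet

variable {n m : ℕ} {f : Fin m → Eucl n ≃ᵈ Eucl n} {E : Set (Eucl n)}

theorem apply_mem (hE : IsSelfSimilarSet f E) (i : Fin m) {x : Eucl n} (hx : x ∈ E) :
    f i x ∈ E := by
  rw [hE.eq_iUnion]
  exact Set.mem_iUnion.2 ⟨i, x, hx, rfl⟩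

theorem image_subset (hE : IsSelfSimilarSet f E) (i : Fin m) : f i '' E ⊆ E :=
  Set.image_subset_iff.2 fun _ hx => hE.apply_mem i hx

theorem exists_apply_eq (hE : IsSelfSimilarSet f E) {x : Eucl n} (hx : x ∈ E) :
    ∃ i, ∃ y ∈ E, f i y = x := by
  rw [hE.eq_iUnion] at hx
  exact Set.mem_iUnion.1 hx

theorem wordMap_mem (hE : IsSelfSimilarSet f E) (w : List (Fin m)) {x : Eucl n} (hx : x ∈ E) :
    wordMap f w x ∈ E := by
  induction w with
  | nil => exact hx
  | cons i w ih => rw [wordMap_cons_apply]; exact hE.apply_mem i ih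

theorem exists_wordMap_eq (hE : IsSelfSimilarSet f E) (k : ℕ) {x : Eucl n} (hx : x ∈ E) :
    ∃ w : List (Fin m), w.length = k ∧ ∃ y ∈ E, wordMap f w y = x := by
  induction k generalizing x with
  | zero => exact ⟨[], rfl, x, hx, rfl⟩
  | succ k ih =>
    obtain ⟨i, y, hy, rfl⟩ := hE.exists_apply_eq hx
    obtain ⟨w, hw, z, hz, rfl⟩ := ih hy
    exact ⟨i :: w, by rw [List.length_cons, hw], z, hz, wordMap_cons_apply f i w z⟩

/-- The cylinder along the first `k` letters of a code of `x` contains `x` and has diameter at most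
`r_w diam E`. -/
theorem exists_wordMap_image_subset (hE : IsSelfSimilarSet f E)
    (hf : ∀ i, Dilation.ratio (f i) < 1) {x : Eucl n} (hx : x ∈ E) {U : Set (Eucl n)}
    (hU : U ∈ 𝓝 x) : ∃ w : List (Fin m), 1 ≤ w.length ∧ wordMap f w '' E ⊆ U := by
  obtain ⟨ε, hε, hεU⟩ := Metric.mem_nhds_iff.1 hU
  choose w hw y hy hwy using fun k => hE.exists_wordMap_eq k hx
  have hlim : Tendsto (fun k => (wordRatio f (w k) : ℝ) * diam E) atTop (𝓝 0) := by
    have h := tendsto_wordRatio_of_length f hf fun k => (hw k).ge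
    simpa using ((NNReal.tendsto_coe.2 h).mul_const (diam E))
  obtain ⟨k, hk, hk1⟩ := ((hlim.eventually_lt_const hε).and (eventually_ge_atTop 1)).exists
  refine ⟨w k, (hw k).symm ▸ hk1, ?_⟩
  rintro _ ⟨z, hz, rfl⟩
  refine hεU (mem_ball.2 ((?_ : _ ≤ _).trans_lt hk))
  conv_lhs => rw [← hwy k]
  rw [Dilation.dist_eq, wordRatio_eq_ratio]
  exact mul_le_mul_of_nonneg_left (dist_le_diam_of_mem hE.isCompact.isBounded hz (hy k))
    NNReal.zero_le_coe

/-- A point of `E` farthest from `O` is the image under some `f_i` of another point of `E`, and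
`f_i` strictly shrinks a positive distance to `O`; so the maximal distance is zero. -/
theorem subset_closure (hE : IsSelfSimilarSet f E) (hf : ∀ i, Dilation.ratio (f i) < 1)
    {O : Set (Eucl n)} (hO : IsFeasible f O) : E ⊆ closure O := by
  obtain ⟨x, hx, hmax⟩ := hE.isCompact.exists_isMaxOn hE.nonempty
    (continuous_infDist_pt O).continuousOn
  have hx0 : infDist x O ≤ 0 := by
    obtain ⟨i, y, hy, rfl⟩ := hE.exists_apply_eq hx
    have h1 := Dilation.infDist_apply_le (f i) hO.nonempty (hO.image_subset i) y
    have h2 : infDist y O ≤ infDist (f i y) O := hmax hy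
    have h3 : (Dilation.ratio (f i) : ℝ) < 1 := by exact_mod_cast hf i
    have h4 : (0 : ℝ) ≤ Dilation.ratio (f i) := NNReal.zero_le_coe
    nlinarith
  intro y hy
  rw [mem_closure_iff_infDist_zero hO.nonempty]
  exact le_antisymm ((show infDist y O ≤ infDist x O from hmax hy).trans hx0) infDist_nonneg

end IsSelfSimilarSet

/-! ### Self-similar measures -/

namespace IsSelfSimilarMeasure

variable {n m : ℕ} {f : Fin m → Eucl n ≃ᵈ Eucl n} {E O : Set (Eucl n)} {p : Fin m → ℝ≥0}
  {μ : Measure (Eucl n)}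

/-- The map `g` is a homeomorphism, so the formula holds for all sets, measurable or not. -/
theorem map_dilation_apply (ν : Measure (Eucl n)) (g : Eucl n ≃ᵈ Eucl n) (A : Set (Eucl n)) :
    ν.map g A = ν (g ⁻¹' A) :=
  g.toHomeomorph.toMeasurableEquiv.map_apply A

theorem measure_eq_sum (hμ : IsSelfSimilarMeasure f p μ) (A : Set (Eucl n)) :
    μ A = ∑ i, (p i : ℝ≥0∞) * μ (f i ⁻¹' A) := by
  conv_lhs => rw [hμ.fixed]
  rw [Measure.finsetSum_apply]
  exact Finset.sum_congr rfl fun i _ => by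
    rw [Measure.smul_apply, map_dilation_apply]; rfl

theorem mul_measure_preimage_le (hμ : IsSelfSimilarMeasure f p μ) (w : List (Fin m))
    (A : Set (Eucl n)) : (wordProd p w : ℝ≥0∞) * μ (wordMap f w ⁻¹' A) ≤ μ A := by
  induction w generalizing A with
  | nil => simp [wordProd, wordMap]
  | cons i w ih =>
    have hset : wordMap f (i :: w) ⁻¹' A = wordMap f w ⁻¹' (f i ⁻¹' A) := by
      ext x; simp only [Set.mem_preimage, wordMap_cons_apply]
    rw [wordProd_cons, ENNReal.coe_mul, mul_assoc, hset, hμ.measure_eq_sum A]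
    exact (mul_le_mul_right (ih _) _).trans
      (Finset.single_le_sum (f := fun i => (p i : ℝ≥0∞) * μ (f i ⁻¹' A))
        (fun _ _ => zero_le) (Finset.mem_univ i))

theorem measure_preimage_eq_zero (hμ : IsSelfSimilarMeasure f p μ) (hp : ∀ i, 0 < p i)
    (w : List (Fin m)) {A : Set (Eucl n)} (hA : μ A = 0) : μ (wordMap f w ⁻¹' A) = 0 := by
  have h := hμ.mul_measure_preimage_le w A
  rw [hA, nonpos_iff_eq_zero, mul_eq_zero, ENNReal.coe_eq_zero] at h
  exact h.resolve_left (wordProd_pos hp w).ne'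

/-- Start from a bound `C` for the distance to `E` on a compact carrier of `μ`. Each use of
invariance improves the bound by the factor `r < 1`. -/
theorem measure_compl_eq_zero (hμ : IsSelfSimilarMeasure f p μ) (hE : IsSelfSimilarSet f E)
    (hf : ∀ i, Dilation.ratio (f i) < 1) : μ Eᶜ = 0 := by
  obtain ⟨K, hK, hμK⟩ := hμ.compactSupport
  obtain ⟨r, hr1, hr⟩ := exists_ratio_le f hf
  obtain ⟨C, hC⟩ := (hK.image (continuous_infDist_pt E)).bddAbove
  have hnull : ∀ k : ℕ, μ {x | (r : ℝ) ^ k * C < infDist x E} = 0 := by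
    intro k
    induction k with
    | zero =>
      refine measure_mono_null (fun x hx => ?_) hμK
      intro hxK
      have h : infDist x E ≤ C := hC ⟨x, hxK, rfl⟩
      have h' : (r : ℝ) ^ 0 * C < infDist x E := hx
      linarith
    | succ k ih =>
      rw [hμ.measure_eq_sum]
      refine Finset.sum_eq_zero fun i _ => mul_eq_zero_of_right _ (measure_mono_null ?_ ih)
      intro x hx
      have hx' : (r : ℝ) ^ (k + 1) * C < infDist (f i x) E := hx
      have h1 := Dilation.infDist_apply_le (f i) hE.nonempty (hE.image_subset i) x
      have h2 : (Dilation.ratio (f i) : ℝ) * infDist x E ≤ r * infDist x E :=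
        mul_le_mul_of_nonneg_right (by exact_mod_cast hr i) infDist_nonneg
      have h3 : (r : ℝ) * (r ^ k * C) < r * infDist x E := by
        rw [pow_succ', mul_assoc] at hx'
        linarith
      exact lt_of_mul_lt_mul_left h3 NNReal.zero_le_coe
  refine measure_mono_null (fun x hx => ?_) (measure_iUnion_null hnull)
  have hpos : 0 < infDist x E :=
    (hE.isCompact.isClosed.notMem_iff_infDist_pos hE.nonempty).1 hx
  have hlim : Tendsto (fun k : ℕ => (r : ℝ) ^ k * C) atTop (𝓝 0) := by
    simpa using (tendsto_pow_atTop_nhds_zero_of_lt_one NNReal.zero_le_coe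
      (by exact_mod_cast hr1 : (r : ℝ) < 1)).mul_const C
  obtain ⟨k, hk⟩ := (hlim.eventually_lt_const hpos).exists
  exact Set.mem_iUnion.2 ⟨k, hk⟩

theorem measure_eq_one (hμ : IsSelfSimilarMeasure f p μ) {A : Set (Eucl n)} (hA : μ Aᶜ = 0) :
    μ A = 1 := by
  have := hμ.isProbabilityMeasure
  refine le_antisymm prob_le_one ?_
  calc (1 : ℝ≥0∞) = μ (A ∪ Aᶜ) := by rw [Set.union_compl_self, measure_univ]
    _ ≤ μ A + μ Aᶜ := measure_union_le _ _
    _ = μ A := by rw [hA, add_zero]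

theorem subset_support (hμ : IsSelfSimilarMeasure f p μ) (hE : IsSelfSimilarSet f E)
    (hf : ∀ i, Dilation.ratio (f i) < 1) (hp : ∀ i, 0 < p i) : E ⊆ μ.support := by
  intro x hx
  refine (Measure.mem_support_iff_forall x).2 fun U hU => ?_
  obtain ⟨w, -, hw⟩ := hE.exists_wordMap_image_subset hf hx hU
  refine pos_iff_ne_zero.2 fun h0 => ?_
  have h1 := measure_mono_null (Set.image_subset_iff.1 hw) (hμ.measure_preimage_eq_zero hp w h0)
  rw [hμ.measure_eq_one (hμ.measure_compl_eq_zero hE hf)] at h1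
  exact one_ne_zero h1

/-! ### Images of subsets of a feasible open set -/

theorem measure_image_of_subset (hμ : IsSelfSimilarMeasure f p μ) (hE : IsSelfSimilarSet f E)
    (hf : ∀ i, Dilation.ratio (f i) < 1) (hO : IsFeasible f O) (i : Fin m) {S : Set (Eucl n)}
    (hS : S ⊆ O) : μ (f i '' S) = p i * μ S := by
  rw [hμ.measure_eq_sum, Finset.sum_eq_single i]
  · rw [Set.preimage_image_eq _ (f i).injective]
  · intro j _ hj
    refine mul_eq_zero_of_right _
      (measure_mono_null (fun x hx => ?_) (hμ.measure_compl_eq_zero hE hf))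
    intro hxE
    -- `f_j⁻¹(f_i(O))` is open and contains `x ∈ closure O`, so it meets `O`; this contradicts the
    -- disjointness of `f_i(O)` and `f_j(O)`.
    have hopen : IsOpen (f j ⁻¹' (f i '' O)) :=
      ((f i).toHomeomorph.isOpenMap O hO.isOpen).preimage (f j).toHomeomorph.continuous
    obtain ⟨y, hy, hyO⟩ := mem_closure_iff.1 (hE.subset_closure hf hO hxE) _ hopen
      (Set.image_mono hS hx)
    exact (hO.disjoint i j hj.symm).notMem_of_mem_left hy ⟨y, hyO, rfl⟩
  · exact fun h => absurd (Finset.mem_univ i) h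

theorem _root_.IsFeasible.wordMap_mem (hO : IsFeasible f O) (w : List (Fin m)) {x : Eucl n}
    (hx : x ∈ O) : wordMap f w x ∈ O := by
  induction w with
  | nil => exact hx
  | cons i w ih => rw [wordMap_cons_apply]; exact hO.image_subset i ⟨_, ih, rfl⟩

theorem measure_wordMap_image (hμ : IsSelfSimilarMeasure f p μ) (hE : IsSelfSimilarSet f E)
    (hf : ∀ i, Dilation.ratio (f i) < 1) (hO : IsFeasible f O) (w : List (Fin m))
    {S : Set (Eucl n)} (hS : S ⊆ O) : μ (wordMap f w '' S) = wordProd p w * μ S := by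
  induction w with
  | nil => simp [wordProd, wordMap]
  | cons i w ih =>
    have hset : wordMap f (i :: w) '' S = f i '' (wordMap f w '' S) := by
      rw [Set.image_image]
      exact Set.image_congr fun x _ => wordMap_cons_apply f i w x
    rw [hset, hμ.measure_image_of_subset hE hf hO i
      (Set.image_subset_iff.2 fun x hx => hO.wordMap_mem w (hS hx)), ih, wordProd_cons,
      ENNReal.coe_mul, mul_assoc]

theorem restrict_wordMap_image (hμ : IsSelfSimilarMeasure f p μ) (hE : IsSelfSimilarSet f E)
    (hf : ∀ i, Dilation.ratio (f i) < 1) (hO : IsFeasible f O) (w : List (Fin m))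
    {B : Set (Eucl n)} (hB : B ⊆ O) :
    μ.restrict (wordMap f w '' B) = wordProd p w • (μ.restrict B).map (wordMap f w) := by
  ext A hA
  have hA' : MeasurableSet (wordMap f w ⁻¹' A) :=
    (Dilation.toContinuous (wordMap f w)).measurable hA
  rw [Measure.smul_apply, map_dilation_apply, Measure.restrict_apply hA,
    Measure.restrict_apply hA', Set.inter_comm A, ← Set.image_inter_preimage, Set.inter_comm B,
    hμ.measure_wordMap_image hE hf hO w (Set.inter_subset_right.trans hB)]
  rfl

theorem restrict_eq_map_symm (hμ : IsSelfSimilarMeasure f p μ) (hE : IsSelfSimilarSet f E)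
    (hf : ∀ i, Dilation.ratio (f i) < 1) (hO : IsFeasible f O) (hp : ∀ i, 0 < p i)
    (w : List (Fin m)) {B : Set (Eucl n)} (hB : B ⊆ O) :
    μ.restrict B =
      (wordProd p w)⁻¹ • (μ.restrict (wordMap f w '' B)).map (wordMap f w).symm := by
  rw [hμ.restrict_wordMap_image hE hf hO w hB, Measure.map_smul, smul_smul,
    inv_mul_cancel₀ (wordProd_pos hp w).ne', one_smul,
    Measure.map_map (Dilation.toContinuous (wordMap f w).symm).measurable
      (Dilation.toContinuous (wordMap f w)).measurable,
    show ((wordMap f w).symm : Eucl n → Eucl n) ∘ wordMap f w = id from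
      funext fun x => (wordMap f w).symm_apply_apply x, Measure.map_id]

end IsSelfSimilarMeasure

/-! ### The geometric shift -/

namespace IsSelfSimilarSet

variable {n m : ℕ} {f : Fin m → Eucl n ≃ᵈ Eucl n} {E : Set (Eucl n)}

theorem exists_mem_codePoint (hE : IsSelfSimilarSet f E) {x : Eucl n} (hx : x ∈ E) :
    ∃ i : ℕ → Fin m, x ∈ codePoint f E i := by
  choose g s hs hgs using fun x : E => hE.exists_apply_eq x.2
  let S : E → E := fun x => ⟨s x, hs x⟩
  refine ⟨fun k => g (S^[k] ⟨x, hx⟩), Set.mem_iInter.2 fun k =>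
    ⟨S^[k] ⟨x, hx⟩, Subtype.coe_prop _, ?_⟩⟩
  induction k with
  | zero => rfl
  | succ k ih =>
    rw [List.range_succ, List.map_append, wordMap_append_apply, List.map_singleton,
      wordMap_cons_apply, wordMap_nil_apply, Function.iterate_succ_apply']
    exact (congrArg _ (hgs _)).trans ih

theorem apply_mem_codePoint (hE : IsSelfSimilarSet f E) {i : ℕ → Fin m} {z : Eucl n}
    (hz : z ∈ codePoint f E fun k => i (k + 1)) : f (i 0) z ∈ codePoint f E i := by
  refine Set.mem_iInter.2 fun k => ?_
  have hz' := Set.mem_iInter.1 hz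
  cases k with
  | zero =>
    obtain ⟨y, hy, hyz⟩ := hz' 0
    exact ⟨f (i 0) z, hE.apply_mem _ (hyz ▸ hy), rfl⟩
  | succ k =>
    obtain ⟨y, hy, hyz⟩ := hz' k
    refine ⟨y, hy, ?_⟩
    rw [List.range_succ_eq_map, List.map_cons, List.map_map, wordMap_cons_apply]
    exact congrArg _ hyz

theorem codePoint_subsingleton (hE : IsSelfSimilarSet f E) (hf : ∀ i, Dilation.ratio (f i) < 1)
    (i : ℕ → Fin m) : (codePoint f E i).Subsingleton := by
  intro x hx y hy
  have hlim : Tendsto (fun k => (wordRatio f ((List.range k).map i) : ℝ) * diam E) atTop (𝓝 0) := by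
    have h := tendsto_wordRatio_of_length f hf (w := fun k => (List.range k).map i)
      fun k => by simp
    simpa using (NNReal.tendsto_coe.2 h).mul_const (diam E)
  refine dist_le_zero.1 (ge_of_tendsto' hlim fun k => ?_)
  obtain ⟨x', hx', rfl⟩ := Set.mem_iInter.1 hx k
  obtain ⟨y', hy', rfl⟩ := Set.mem_iInter.1 hy k
  rw [Dilation.dist_eq, wordRatio_eq_ratio]
  exact mul_le_mul_of_nonneg_left (dist_le_diam_of_mem hE.isCompact.isBounded hx' hy')
    NNReal.zero_le_coe

/-- Prepending `j` to a code of `z` gives a code of `f_j(z)`, and a code determines its point. The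
shift is therefore the union of the inverse branches on `E`. -/
theorem mem_geomShift_iff (hE : IsSelfSimilarSet f E) (hf : ∀ i, Dilation.ratio (f i) < 1)
    {A : Set (Eucl n)} {z : Eucl n} :
    z ∈ geomShift f E A ↔ z ∈ E ∧ ∃ i, f i z ∈ A := by
  constructor
  · rintro ⟨i, ⟨y, hy, hyA⟩, hz⟩
    obtain ⟨x, hx, hxz⟩ := Set.mem_iInter.1 hz 0
    refine ⟨hxz ▸ hx, i 0, ?_⟩
    rwa [hE.codePoint_subsingleton hf i (hE.apply_mem_codePoint hz) hy]
  · rintro ⟨hz, j, hj⟩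
    obtain ⟨i, hi⟩ := hE.exists_mem_codePoint hz
    let i' : ℕ → Fin m := fun k => Nat.casesOn k j i
    exact ⟨i', ⟨f j z, hE.apply_mem_codePoint (i := i') hi, hj⟩, hi⟩

theorem mem_iterate_geomShift_iff (hE : IsSelfSimilarSet f E)
    (hf : ∀ i, Dilation.ratio (f i) < 1) {A : Set (Eucl n)} {z : Eucl n} (k : ℕ) :
    z ∈ (geomShift f E)^[k + 1] A ↔
      z ∈ E ∧ ∃ w : List (Fin m), w.length = k + 1 ∧ wordMap f w z ∈ A := by
  induction k generalizing z with
  | zero =>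
    rw [zero_add, Function.iterate_one, hE.mem_geomShift_iff hf]
    refine and_congr_right fun _ => ⟨fun ⟨i, hi⟩ => ⟨[i], rfl, hi⟩, ?_⟩
    rintro ⟨w, hw, hwz⟩
    obtain ⟨i, rfl⟩ := List.length_eq_one_iff.1 hw
    exact ⟨i, hwz⟩
  | succ k ih =>
    rw [Function.iterate_succ_apply', hE.mem_geomShift_iff hf]
    refine and_congr_right fun hz => ⟨?_, ?_⟩
    · rintro ⟨i, hi⟩
      obtain ⟨-, w, hw, hwz⟩ := ih.1 hi
      refine ⟨w ++ [i], by simp [hw], ?_⟩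
      rwa [wordMap_append_apply]
    · rintro ⟨w, hw, hwz⟩
      have hne : w ≠ [] := by rintro rfl; simp at hw
      -- The outermost shift undoes the innermost map, so the letter to peel off is the last one.
      refine ⟨w.getLast hne, ih.2 ⟨hE.apply_mem _ hz, w.dropLast, by simp [hw], ?_⟩⟩
      rw [← List.dropLast_append_getLast hne, wordMap_append_apply] at hwz
      exact hwz

theorem mem_denseOrbitSet_iff (hE : IsSelfSimilarSet f E) (hf : ∀ i, Dilation.ratio (f i) < 1)
    {y : Eucl n} : y ∈ denseOrbitSet f E ↔ y ∈ E ∧ ∀ x ∈ E, ∀ U ∈ 𝓝 x, ∃ z ∈ U, z ∈ E ∧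
      ∃ w : List (Fin m), 1 ≤ w.length ∧ wordMap f w z = y := by
  refine and_congr_right fun _ => forall₂_congr fun x _ => ?_
  rw [mem_closure_iff_nhds]
  refine forall₂_congr fun U _ => ⟨?_, ?_⟩
  · rintro ⟨z, hzU, hz⟩
    obtain ⟨k, hk⟩ := Set.mem_iUnion.1 hz
    obtain ⟨hzE, w, hw, hwz⟩ := (hE.mem_iterate_geomShift_iff hf k).1 hk
    exact ⟨z, hzU, hzE, w, by lia, hwz⟩
  · rintro ⟨z, hzU, hzE, w, hw, hwz⟩
    exact ⟨z, hzU, Set.mem_iUnion.2 ⟨w.length - 1,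
      (hE.mem_iterate_geomShift_iff hf _).2 ⟨hzE, w, by lia, hwz⟩⟩⟩

end IsSelfSimilarSet

/-! ### Almost every point has a dense orbit -/

namespace IsSelfSimilarMeasure

variable {n m : ℕ} {f : Fin m → Eucl n ≃ᵈ Eucl n} {E O : Set (Eucl n)} {p : Fin m → ℝ≥0}
  {μ : Measure (Eucl n)}

theorem measure_diff_wordMap_preimage (hμ : IsSelfSimilarMeasure f p μ) (hp : ∀ i, 0 < p i)
    (hsum : ∑ i, p i = 1) {N : Set (Eucl n)} (hN : MeasurableSet N)
    (hinv : ∀ i, f i ⁻¹' N ⊆ N) (w : List (Fin m)) : μ (N \ wordMap f w ⁻¹' N) = 0 := by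
  have := hμ.isProbabilityMeasure
  have hone : ∀ i, μ (N \ f i ⁻¹' N) = 0 := by
    intro i
    have h := ENNReal.eq_of_sum_mul_eq hp hsum (measure_ne_top μ N)
      (fun j => measure_mono (hinv j)) (hμ.measure_eq_sum N).symm i
    rw [measure_sdiff (hinv i) ((Dilation.toContinuous (f i)).measurable hN).nullMeasurableSet
      (measure_ne_top _ _), h, tsub_self]
  induction w with
  | nil => simp [wordMap]
  | cons i w ih =>
    refine measure_mono_null (fun x hx => ?_)
      (measure_union_null ih (hμ.measure_preimage_eq_zero hp w (hone i)))
    obtain ⟨hxN, hx⟩ := hx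
    rw [Set.mem_preimage, wordMap_cons_apply] at hx
    by_cases h : wordMap f w x ∈ N
    · exact Or.inr ⟨h, hx⟩
    · exact Or.inl ⟨hxN, h⟩

theorem measure_compl_denseOrbitSet (hμ : IsSelfSimilarMeasure f p μ)
    (hE : IsSelfSimilarSet f E) (hf : ∀ i, Dilation.ratio (f i) < 1) (hp : ∀ i, 0 < p i)
    (hsum : ∑ i, p i = 1) : μ (denseOrbitSet f E)ᶜ = 0 := by
  -- `G v` is the set of points of `E` having a code in which `v` occurs after at least one letter.
  let G : List (Fin m) → Set (Eucl n) := fun v =>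
    ⋃ (w : List (Fin m)) (_ : 1 ≤ w.length), wordMap f (w ++ v) '' E
  have hmemG : ∀ v y, y ∈ G v ↔ ∃ w : List (Fin m), 1 ≤ w.length ∧
      ∃ e ∈ E, wordMap f (w ++ v) e = y := fun v y => by
    simp only [G, Set.mem_iUnion, exists_prop, Set.mem_image]
  have hG : ∀ v : List (Fin m), 1 ≤ v.length → μ (G v)ᶜ = 0 := by
    intro v hv
    have hmeas : MeasurableSet (G v)ᶜ :=
      (MeasurableSet.iUnion fun w => MeasurableSet.iUnion fun _ =>
        (hE.isCompact.image (Dilation.toContinuous (wordMap f (w ++ v)))).measurableSet).compl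
    -- In `v ++ v` the first copy is the nonempty prefix required by `G v`, so `f_{vv}(E) ⊆ G v`.
    have h := hμ.measure_diff_wordMap_preimage hp hsum hmeas (fun i x hx hxG => hx ?_) (v ++ v)
    · refine measure_mono_null (fun x hx => ?_)
        (measure_union_null h (hμ.measure_compl_eq_zero hE hf))
      by_cases hxE : x ∈ E
      · exact Or.inl ⟨hx, fun h => h ((hmemG _ _).2 ⟨v, hv, x, hxE, rfl⟩)⟩
      · exact Or.inr hxE
    · obtain ⟨w, -, e, he, rfl⟩ := (hmemG _ _).1 hxG
      exact (hmemG _ _).2 ⟨i :: w, by simp, e, he, wordMap_cons_apply f i (w ++ v) e⟩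
  refine measure_mono_null (fun y hy => ?_) (measure_union_null (hμ.measure_compl_eq_zero hE hf)
    (measure_iUnion_null fun v => measure_iUnion_null (hG v)))
  by_contra hcon
  simp only [Set.mem_union, Set.mem_iUnion, Set.mem_compl_iff, not_or, not_not, not_exists] at hcon
  refine hy ((hE.mem_denseOrbitSet_iff hf).2 ⟨hcon.1, fun x hx U hU => ?_⟩)
  obtain ⟨v, hv, hvU⟩ := hE.exists_wordMap_image_subset hf hx hU
  obtain ⟨w, hw, e, he, hwe⟩ := (hmemG _ _).1 (hcon.2 v hv)
  exact ⟨wordMap f v e, hvU ⟨e, he, rfl⟩, hE.wordMap_mem v he, w, hw,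
    (wordMap_append_apply f w v e).symm.trans hwe⟩

end IsSelfSimilarMeasure

/-! ### Spheres are null -/

/-- The continuous function `y ↦ |y - c|²` on a subset of `ℝⁿ`. -/
noncomputable def sqDistMap {n : ℕ} (E : Set (Eucl n)) (c : Eucl n) : C(E, ℝ) :=
  ⟨fun y => dist (y : Eucl n) c ^ 2, by fun_prop⟩

/-- The space of functions on `E ⊆ ℝⁿ` spanned by the constants and the squared distances to
points of `ℝⁿ`. -/
noncomputable def sqDistSpan {n : ℕ} (E : Set (Eucl n)) : Submodule ℝ C(E, ℝ) :=
  Submodule.span ℝ (insert 1 (Set.range (sqDistMap E)))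

/-- Expanding `|y - c|²` shows that all generators have the form `a|y|² + ⟨b, y⟩ + c'`. -/
theorem finiteDimensional_sqDistSpan {n : ℕ} (E : Set (Eucl n)) :
    FiniteDimensional ℝ (sqDistSpan E) := by
  let L : (ℝ × Eucl n × ℝ) →ₗ[ℝ] C(E, ℝ) :=
    { toFun := fun q => ⟨fun y => q.1 * ‖(y : Eucl n)‖ ^ 2 + inner ℝ q.2.1 (y : Eucl n) + q.2.2,
        by fun_prop⟩
      map_add' := fun q q' => by
        ext y
        simp only [Prod.fst_add, Prod.snd_add, inner_add_left, ContinuousMap.add_apply,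
          ContinuousMap.coe_mk]
        ring
      map_smul' := fun t q => by
        ext y
        simp only [Prod.smul_fst, Prod.smul_snd, real_inner_smul_left, ContinuousMap.smul_apply,
          ContinuousMap.coe_mk, smul_eq_mul, RingHom.id_apply]
        ring }
  refine Submodule.finiteDimensional_of_le (S₂ := LinearMap.range L) (Submodule.span_le.2 ?_)
  rintro _ (rfl | ⟨c, rfl⟩)
  · exact ⟨(0, 0, 1), by ext y; simp [L]⟩
  · refine ⟨(1, (-2 : ℝ) • c, ‖c‖ ^ 2), ?_⟩
    ext y
    simp only [L, sqDistMap, LinearMap.coe_mk, AddHom.coe_mk, ContinuousMap.coe_mk, dist_eq_norm,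
      norm_sub_sq_real, real_inner_smul_left, real_inner_comm c]
    ring

namespace IsSelfSimilarMeasure

variable {n m : ℕ} {f : Fin m → Eucl n ≃ᵈ Eucl n} {E O : Set (Eucl n)} {p : Fin m → ℝ≥0}
  {μ : Measure (Eucl n)}

/-- A self-similar measure does not charge spheres centred in the self-similar set. -/
theorem measure_sphere_eq_zero (hμ : IsSelfSimilarMeasure f p μ)
    (hE : IsSelfSimilarSet f E) (hf : ∀ i, Dilation.ratio (f i) < 1) (hp : ∀ i, 0 < p i)
    (hsum : ∑ i, p i = 1) {x : Eucl n} (hx : x ∈ E) {d : ℝ} (hd : 0 < d) :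
    μ (sphere x d) = 0 := by
  have := hμ.isProbabilityMeasure
  have : CompactSpace E := isCompact_iff_compactSpace.1 hE.isCompact
  have := finiteDimensional_sqDistSpan E
  have hEm : MeasurableSet E := hE.isCompact.measurableSet
  have hconull := hμ.measure_compl_eq_zero hE hf
  let φ : Fin m → C(E, E) := fun i =>
    ⟨fun y => ⟨f i y, hE.apply_mem i y.2⟩,
      ((Dilation.toContinuous (f i)).comp continuous_subtype_val).subtype_mk _⟩
  have hφ : ∀ (w : List (Fin m)) (y : E), (contWordMap φ w y : Eucl n) = wordMap f w y := by
    intro w y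
    induction w with
    | nil => rfl
    | cons i w ih => rw [wordMap_cons_apply, ← ih]; rfl
  let ν : Measure E := μ.comap Subtype.val
  have hν : ∀ A : Set E, ν A = μ (Subtype.val '' A) := fun A => comap_subtype_coe_apply hEm μ A
  have hfin : IsFiniteMeasure ν := ⟨by rw [hν]; exact measure_lt_top _ _⟩
  -- Since `|f_i(y) - f_i(c)|² = r_i² |y - c|²` and every centre is some `f_i(c)`, composition with
  -- `f_i` permutes the generators up to nonzero factors.
  have hT : ∀ i, (sqDistSpan E).map (ContinuousMap.compRightAlgHom ℝ ℝ (φ i)).toLinearMap =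
      sqDistSpan E := by
    intro i
    have hr : (Dilation.ratio (f i) : ℝ) ≠ 0 := by exact_mod_cast Dilation.ratio_ne_zero (f i)
    have hcomp : ∀ c, (sqDistMap E (f i c)).comp (φ i) =
        (Dilation.ratio (f i) : ℝ) ^ 2 • sqDistMap E c := by
      intro c
      ext y
      change dist (f i y) (f i c) ^ 2 = _ * dist (y : Eucl n) c ^ 2
      rw [Dilation.dist_eq, mul_pow]
    have hmem : ∀ c, sqDistMap E c ∈ sqDistSpan E :=
      fun c => Submodule.subset_span (Or.inr ⟨c, rfl⟩)
    have hone : (1 : C(E, ℝ)) ∈ sqDistSpan E := Submodule.subset_span (Or.inl rfl)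
    refine le_antisymm (Submodule.map_le_iff_le_comap.2 (Submodule.span_le.2 ?_))
      (Submodule.span_le.2 ?_)
    · rintro _ (rfl | ⟨c, rfl⟩)
      · exact hone
      · obtain ⟨c, rfl⟩ := (f i).surjective c
        change (sqDistMap E (f i c)).comp (φ i) ∈ sqDistSpan E
        rw [hcomp]
        exact Submodule.smul_mem _ _ (hmem c)
    · rintro _ (rfl | ⟨c, rfl⟩)
      · exact ⟨1, hone, rfl⟩
      · refine ⟨((Dilation.ratio (f i) : ℝ) ^ 2)⁻¹ • sqDistMap E (f i c),
          Submodule.smul_mem _ _ (hmem _), ?_⟩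
        change ((Dilation.ratio (f i) : ℝ) ^ 2)⁻¹ • (sqDistMap E (f i c)).comp (φ i) = _
        rw [hcomp, smul_smul, inv_mul_cancel₀ (pow_ne_zero 2 hr), one_smul]
  have key := measure_zeroSet_eq_zero ν φ p hp hsum ?_ ?_ (sqDistSpan E)
    (fun i q hq => (hT i).le ⟨q, hq, rfl⟩) (fun i q hq => (hT i).ge hq)
    (q := sqDistMap E x - (d ^ 2) • (1 : C(E, ℝ)))
    (Submodule.sub_mem _ (Submodule.subset_span (Or.inr ⟨x, rfl⟩))
      (Submodule.smul_mem _ _ (Submodule.subset_span (Or.inl rfl)))) ?_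
  · rw [hν] at key
    refine measure_mono_null (fun y hy => ?_) (measure_union_null key hconull)
    by_cases hyE : y ∈ E
    · refine Or.inl ⟨⟨y, hyE⟩, ?_, rfl⟩
      have hy' : dist y x = d := hy
      simp [sqDistMap, hy']
    · exact Or.inr hyE
  · intro A _
    rw [hν, hμ.measure_eq_sum]
    refine Finset.sum_congr rfl fun i _ => ?_
    rw [hν, ← measure_inter_conull hconull]
    congr 2
    ext y
    constructor
    · rintro ⟨⟨a, ha, hay⟩, hy⟩
      refine ⟨⟨y, hy⟩, ?_, rfl⟩
      rwa [Set.mem_preimage, show φ i ⟨y, hy⟩ = a from Subtype.ext hay.symm]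
    · rintro ⟨a, ha, rfl⟩
      exact ⟨⟨_, ha, rfl⟩, a.2⟩
  · rintro U hU ⟨y, hy⟩
    obtain ⟨V, hV, rfl⟩ := isOpen_induced_iff.1 hU
    obtain ⟨w, -, hw⟩ := hE.exists_wordMap_image_subset hf y.2 (hV.mem_nhds hy)
    exact ⟨w, fun z => by
      rw [Set.mem_preimage, hφ]
      exact hw ⟨z, z.2, rfl⟩⟩
  -- The centre `x` belongs to `E`, and there the function equals `-d² ≠ 0`.
  · intro h
    have h' := DFunLike.congr_fun h ⟨x, hx⟩
    simp [sqDistMap, hd.ne'] at h'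

/-! ### Strong convergence -/

/-- Off the limit sphere the indicators of the balls converge pointwise, and a finite measure allows
dominated convergence. -/
theorem strongTendsto_restrict_closedBall [IsFiniteMeasure μ] {x : Eucl n} {d : ℝ}
    (hμx : μ (sphere x d) = 0) {z : ℕ → Eucl n} (hz : Tendsto z atTop (𝓝 x)) :
    StrongTendsto (fun j => μ.restrict (closedBall (z j) d)) (μ.restrict (closedBall x d)) := by
  intro A hA
  simp only [Measure.restrict_apply hA]
  refine tendsto_measure_of_ae_tendsto_indicator_of_isFiniteMeasure atTop
    (hA.inter measurableSet_closedBall) (fun j => hA.inter measurableSet_closedBall) ?_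
  have hae : ∀ᵐ y ∂μ, y ∉ sphere x d := measure_eq_zero_iff_ae_notMem.1 hμx
  filter_upwards [hae] with y hy
  have hlim : Tendsto (fun j => dist y (z j)) atTop (𝓝 (dist y x)) := tendsto_const_nhds.dist hz
  simp only [Set.mem_inter_iff, mem_closedBall]
  rcases lt_or_gt_of_ne (show dist y x ≠ d from hy) with h | h
  · filter_upwards [hlim.eventually_lt_const h] with j hj
    simp [hj.le, h.le]
  · filter_upwards [hlim.eventually_const_lt h] with j hj
    simp [hj.not_ge, h.not_ge]

/-- Density alone gives no control on the length of the word. Applying it near `f_u(x)`, inside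
`f_u(U)` with `u` of length `k`, yields the word `v ++ u`. -/
theorem _root_.exists_wordMap_eq_near (hE : IsSelfSimilarSet f E)
    (hf : ∀ i, Dilation.ratio (f i) < 1) {x y : Eucl n} (hx : x ∈ E)
    (hy : y ∈ denseOrbitSet f E) {U : Set (Eucl n)} (hU : U ∈ 𝓝 x) (k : ℕ) :
    ∃ w : List (Fin m), k ≤ w.length ∧ ∃ z ∈ U, wordMap f w z = y := by
  obtain ⟨u, hu, -⟩ := hE.exists_wordMap_eq k hx
  obtain ⟨z, ⟨z', hz', rfl⟩, -, v, -, hv⟩ := ((hE.mem_denseOrbitSet_iff hf).1 hy).2 _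
    (hE.wordMap_mem u hx) (wordMap f u '' U) ((wordMap f u).toHomeomorph.isOpenMap.image_mem_nhds hU)
  exact ⟨v ++ u, by simp [hu], z', hz', (wordMap_append_apply f v u z').trans hv⟩

theorem exists_strongTendsto (hμ : IsSelfSimilarMeasure f p μ)
    (hE : IsSelfSimilarSet f E) (hf : ∀ i, Dilation.ratio (f i) < 1) (hp : ∀ i, 0 < p i)
    (hsum : ∑ i, p i = 1) (hO : IsFeasible f O) {x : Eucl n} (hx : x ∈ E) {d : ℝ} (hd : 0 < d)
    (hxO : closedBall x d ⊆ O) {y : Eucl n} (hy : y ∈ denseOrbitSet f E) :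
    ∃ w : ℕ → List (Fin m),
      Tendsto (fun j => wordRatio f (w j)) atTop (𝓝 0) ∧
      StrongTendsto
        (fun j => (wordProd p (w j))⁻¹ •
          (μ.restrict (closedBall y (d * wordRatio f (w j)))).map (wordMap f (w j)).symm)
        (μ.restrict (closedBall x d)) := by
  have := hμ.isProbabilityMeasure
  -- This margin keeps `B(z, d)` inside `O` for `z` near `x`, so that scaling applies to the moved
  -- balls.
  obtain ⟨δ, hδ, hδO⟩ := (isCompact_closedBall x d).exists_cthickening_subset_open hO.isOpen hxO
  have hsub : ∀ z ∈ ball x δ, closedBall z d ⊆ O := by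
    intro z hz v hv
    refine hδO (mem_cthickening_of_dist_le v (v + (x - z)) δ _ ?_ ?_)
    · rw [mem_closedBall, dist_eq_norm] at hv ⊢
      rwa [show v + (x - z) - x = v - z by abel]
    · rw [dist_eq_norm, show v - (v + (x - z)) = z - x by abel, ← dist_eq_norm]
      exact (mem_ball.1 hz).le
  choose w hw z hz hwz using fun j : ℕ => exists_wordMap_eq_near hE hf hx hy
    (ball_mem_nhds x (lt_min hδ (Nat.one_div_pos_of_nat (α := ℝ) (n := j)))) j
  have hzx : Tendsto z atTop (𝓝 x) := by
    rw [tendsto_iff_dist_tendsto_zero]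
    exact squeeze_zero (fun _ => dist_nonneg)
      (fun j => (mem_ball.1 (hz j)).le.trans (min_le_right _ _))
      tendsto_one_div_add_atTop_nhds_zero_nat
  refine ⟨w, tendsto_wordRatio_of_length f hf hw, ?_⟩
  have heq : ∀ j, (wordProd p (w j))⁻¹ •
      (μ.restrict (closedBall y (d * wordRatio f (w j)))).map (wordMap f (w j)).symm =
        μ.restrict (closedBall (z j) d) := by
    intro j
    have himg : wordMap f (w j) '' closedBall (z j) d =
        closedBall y (d * wordRatio f (w j)) := by
      rw [← Dilation.preimage_closedBall_apply (wordMap f (w j)) (z j) d,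
        Set.image_preimage_eq _ (wordMap f (w j)).surjective, hwz, wordRatio_eq_ratio]
    rw [hμ.restrict_eq_map_symm hE hf hO hp (w j)
      (hsub _ (ball_subset_ball (min_le_left _ _) (hz j))), himg]
  simp only [heq]
  exact strongTendsto_restrict_closedBall (hμ.measure_sphere_eq_zero hE hf hp hsum hx hd) hzx

/-! ### Tangent measures -/

/-- Neither `μ` nor `Ê` depends on the feasible set, so each typical ball may use its own. -/
theorem typicalClasses_subset (hμ : IsSelfSimilarMeasure f p μ)
    (hE : IsSelfSimilarSet f E) (hf : ∀ i, Dilation.ratio (f i) < 1) (hp : ∀ i, 0 < p i)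
    (hsum : ∑ i, p i = 1) (R : ℝ) {x : Eucl n} (hx : x ∈ denseOrbitSet f E) :
    typicalClasses R f E μ ⊆ strongTangentClasses R μ x := by
  rintro C ⟨α, rfl, z, d, ⟨hd, hz, O, hO, hzO⟩, hdR, hα⟩
  have := hμ.isProbabilityMeasure
  have hsupp := hμ.subset_support hE hf hp
  have hball : ∀ y ∈ E, ∀ ρ : ℝ, 0 < ρ → μ (closedBall y ρ) ≠ 0 := fun y hy ρ hρ =>
    ((Measure.mem_support_iff_forall y).1 (hsupp hy) _ (closedBall_mem_nhds y hρ)).ne'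
  obtain ⟨w, hw, hlim⟩ := hμ.exists_strongTendsto hE hf hp hsum hO hz hd hzO hx
  have hratio : ∀ j, Dilation.ratio (wordMap f (w j)).symm = (wordRatio f (w j))⁻¹ := fun j => by
    rw [DilationEquiv.ratio_symm, wordRatio_eq_ratio]
  have hdiv : ∀ j, d / (Dilation.ratio (wordMap f (w j)).symm : ℝ) = d * wordRatio f (w j) :=
    fun j => by rw [hratio, NNReal.coe_inv, div_inv_eq_mul]
  have hpos : ∀ j, 0 < d * (wordRatio f (w j) : ℝ) := fun j =>
    mul_pos hd (by exact_mod_cast wordRatio_pos f (w j))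
  have hne : ∀ j, μ (closedBall x (d * wordRatio f (w j))) ≠ 0 := fun j =>
    hball x hx.1 _ (hpos j)
  -- The zooming maps are `f_{w_j}⁻¹`, of ratio `r_{w_j}⁻¹ → ∞`. The constants `c_j` replace the
  -- normalisation by `μ(B(x, d r_{w_j}))` with the weight `p_{w_j}⁻¹`; they are positive because `E
  -- ⊆ spt μ`.
  refine ⟨hsupp hx.1, α, rfl, ?_, d, hd, hdR,
    fun j => (wordProd p (w j))⁻¹ * (μ (closedBall x (d * wordRatio f (w j)))).toNNReal,
    fun j => (wordMap f (w j)).symm, fun j => ?_, ?_, ?_⟩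
  · rw [hα]
    exact fun h => hball z hz d hd (Measure.restrict_eq_zero.1 h)
  · exact mul_pos (inv_pos.2 (wordProd_pos hp _))
      (ENNReal.toNNReal_pos (hne j) (measure_ne_top _ _))
  · simp only [hratio]
    exact (tendsto_inv_nhdsGT_zero (𝕜 := ℝ≥0)).comp (tendsto_nhdsWithin_iff.2
      ⟨hw, Eventually.of_forall fun j => wordRatio_pos f (w j)⟩)
  · rw [hα]
    convert hlim using 2 with j
    rw [zoom, hdiv, mul_smul]
    congr 1
    ext A _
    rw [Measure.smul_apply, Measure.smul_apply, smul_eq_mul, ENNReal.smul_def, smul_eq_mul,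
      ENNReal.coe_toNNReal (measure_ne_top _ _), ← mul_assoc,
      ENNReal.mul_inv_cancel (hne j) (measure_ne_top _ _), one_mul]

end IsSelfSimilarMeasure
theorem theorem3p5 {n m : ℕ} (f : Fin m → Eucl n ≃ᵈ Eucl n)
    (hf : ∀ i, Dilation.ratio (f i) < 1)
    (E : Set (Eucl n)) (hE : IsSelfSimilarSet f E)
    (O : Set (Eucl n)) (hO : IsFeasible f O)
    (p : Fin m → ℝ≥0) (hp : ∀ i, 0 < p i) (hsum : ∑ i, p i = 1)
    (μ : Measure (Eucl n)) (hμ : IsSelfSimilarMeasure f p μ) :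
    (∀ B : Set (Eucl n), B ⊆ O → NullMeasurableSet B μ → ∀ w : List (Fin m),
      μ.restrict (wordMap f w '' B) = wordProd p w • (μ.restrict B).map (wordMap f w)) ∧
    (∀ B : Set (Eucl n), B ⊆ O → NullMeasurableSet B μ → ∀ w : List (Fin m),
      μ.restrict B =
        (wordProd p w)⁻¹ • (μ.restrict (wordMap f w '' B)).map (wordMap f w).symm) ∧
    (denseOrbitSet f E ⊆ E ∧ μ (denseOrbitSet f E) = 1 ∧ μ (denseOrbitSet f E)ᶜ = 0 ∧
      ∀ x ∈ E, ∀ d : ℝ, 0 < d → closedBall x d ⊆ O → ∀ y ∈ denseOrbitSet f E,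
        ∃ w : ℕ → List (Fin m),
          Tendsto (fun j => wordRatio f (w j)) atTop (𝓝 0) ∧
          StrongTendsto
            (fun j => (wordProd p (w j))⁻¹ •
              (μ.restrict (closedBall y (d * wordRatio f (w j)))).map (wordMap f (w j)).symm)
            (μ.restrict (closedBall x d))) ∧
    (∀ R : ℝ, 0 < R → ∀ x ∈ denseOrbitSet f E,
      typicalClasses R f E μ ⊆ strongTangentClasses R μ x) := by
  have hcompl := hμ.measure_compl_denseOrbitSet hE hf hp hsum
  exact ⟨fun _ hB _ w => hμ.restrict_wordMap_image hE hf hO w hB,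
    fun _ hB _ w => hμ.restrict_eq_map_symm hE hf hO hp w hB,
    ⟨fun _ hy => hy.1, hμ.measure_eq_one hcompl, hcompl, fun _ hx _ hd hxO _ hy =>
      hμ.exists_strongTendsto hE hf hp hsum hO hx hd hxO hy⟩,
    fun R _ _ hx => hμ.typicalClasses_subset hE hf hp hsum R hx⟩
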